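/- Let $H$ be a complex Hilbert space, with inner product $\langle\cdot,\cdot\rangle$ linear in the second variable, and let $|x\rangle\langle y|$ denote the operator $z\mapsto\langle y,z\rangle x$. Let $(T_t)_{t\ge 0}$ be a quantum Markov semigroup on $B(H)$: each $T_t:B(H)\to B(H)$ is linear, completely positive and $\sigma$-weakly continuous, $T_0=\mathrm{id}$, $T_{t+s}=T_tT_s$, $T_t(1)=1$, and $t\mapsto T_t(A)$ is $\sigma$-weakly continuous for every $A\in B(H)$. Let $L$ be its generator: $D(L)$ is the set of $A\in B(H)$ for which $\frac1t(T_tA-A)$ converges $\sigma$-weakly as $t\to0^+$, and $L(A)$ is this limit. For linear subspaces $W\subseteq H$ and $\mathcal A\subseteq B(H)$, a linear map $\phi$ from $\mathcal A$ to the sesquilinear forms on $W\times W$ (conjugate linear in the first variable) is called $W$-completely positive if $\sum_{i,j=1}^k\phi(A_{ij})(u_i,u_j)\ge0$ for all $k$, all matrices $(A_{ij})\in M_k(\mathcal A)$ that are positive in $M_k(B(H))$, and all $u_1,\dots,u_k\in W$. **Theorem 3.6.** There are a linear (not necessarily closed) subspace $W$ of $H$, a $W$-completely positive map $\phi$ from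 $D(L)$ to the sesquilinear forms on $W\times W$, and a linear operator $K:W\to H$ such that $$\langle u,L(A)v\rangle=\phi(A)(u,v)+\langle Ku,Av\rangle+\langle u,AKv\rangle\qquad\text{for all }A\in D(L),\ u,v\in W.\tag{1}$$ More precisely, $W$ and $K$ can be taken as follows. For every $\varepsilon>0$ the map $1-\varepsilon L:D(L)\to B(H)$ is bijective and $L_\varepsilon=L(1-\varepsilon L)^{-1}$ is a bounded operator on $B(H)$. Let $T=\sum_{s=1}^m t_s|k_s\rangle\langle k_s|$ be a nonzero positive finite rank operator, with $k_1,\dots,k_m$ orthonormal and $t_s>0$, and let $h=(\sum_s t_s)^{-1/2}\sum_s k_s$. For $\varepsilon>0$ the formula $$G_\varepsilon x=L_\varepsilon\big(|x\rangle\langle Th|\big)h-\tfrac12\langle h,L_\varepsilon(T)h\rangle x$$ defines $G_\varepsilon\in B(H)$. Put $$W=\{u\in H:\ \lim_{\varepsilon\to0^+}\langle g,G_\varepsilon^*u\rangle\text{ exists for all }g\in H\}.$$ Then $W$ is a linear subspace, for each $u\in W$ the weak limit $Ku=\text{weak-}\lim_{\varepsilon\to0^+}G_\varepsilon^*u$ exists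 and defines a linear operator $K:W\to H$, and for this $W$ and this $K$ there is a $W$-completely positive map $\phi$ on $D(L)$ satisfying (1). -/

import Mathlib

open scoped ComplexOrder InnerProductSpace NNReal Topology CStarAlgebra
open Filter

noncomputable section

/-- A pair of square-summable sequences of vectors of `H`. Such a pair `(x, y)` represents the
trace-class operator `∑ₙ |yₙ⟩⟨xₙ|`, and every trace-class operator is of this form. -/
structure SquareSummablePair (H : Type*) [NormedAddCommGroup H] where
  left : ℕ → H
  right : ℕ → H
  summable_left : Summable fun n => ‖left n‖ ^ 2
  summable_right : Summable fun n => ‖right n‖ ^ 2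

section

variable {H : Type*} [NormedAddCommGroup H] [InnerProductSpace ℂ H]

/-- The functional `A ↦ ∑ₙ ⟨xₙ, A yₙ⟩ = tr (A ∑ₙ |yₙ⟩⟨xₙ|)` on `B(H)`; the series converges
absolutely. -/
def SquareSummablePair.functional (p : SquareSummablePair H) (A : H →L[ℂ] H) : ℂ :=
  ∑' n, ⟪p.left n, A (p.right n)⟫_ℂ

theorem SquareSummablePair.summable (p : SquareSummablePair H) (A : H →L[ℂ] H) :
    Summable fun n => ⟪p.left n, A (p.right n)⟫_ℂ := by
  refine Summable.of_norm_bounded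
    (g := fun n => ‖A‖ * (‖p.left n‖ ^ 2 + ‖p.right n‖ ^ 2))
    ((p.summable_left.add p.summable_right).mul_left _) fun n => ?_
  calc ‖⟪p.left n, A (p.right n)⟫_ℂ‖ ≤ ‖p.left n‖ * ‖A (p.right n)‖ := norm_inner_le_norm _ _
    _ ≤ ‖p.left n‖ * (‖A‖ * ‖p.right n‖) := by gcongr; exact A.le_opNorm _
    _ = ‖A‖ * (‖p.left n‖ * ‖p.right n‖) := by ring
    _ ≤ ‖A‖ * (‖p.left n‖ ^ 2 + ‖p.right n‖ ^ 2) := by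
        gcongr
        nlinarith [sq_nonneg (‖p.left n‖ - ‖p.right n‖), sq_nonneg ‖p.left n‖,
          sq_nonneg ‖p.right n‖]

theorem SquareSummablePair.functional_add (p : SquareSummablePair H) (A B : H →L[ℂ] H) :
    p.functional (A + B) = p.functional A + p.functional B := by
  simp only [functional, add_apply, inner_add_right]
  exact (p.summable A).tsum_add (p.summable B)

theorem SquareSummablePair.functional_smul (p : SquareSummablePair H) (c : ℂ) (A : H →L[ℂ] H) :
    p.functional (c • A) = c * p.functional A := by
  simp only [functional, smul_apply, inner_smul_right, tsum_mul_left]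

/-- The rank-one pair, whose functional is `A ↦ ⟨x, A y⟩`. -/
def SquareSummablePair.single (x y : H) : SquareSummablePair H where
  left := Pi.single 0 x
  right := Pi.single 0 y
  summable_left := summable_of_ne_finset_zero (s := {0}) fun n hn => by
    simp [Pi.single_eq_of_ne (by simpa using hn : n ≠ 0)]
  summable_right := summable_of_ne_finset_zero (s := {0}) fun n hn => by
    simp [Pi.single_eq_of_ne (by simpa using hn : n ≠ 0)]

theorem SquareSummablePair.functional_single (x y : H) (A : H →L[ℂ] H) :
    (SquareSummablePair.single x y).functional A = ⟪x, A y⟫_ℂ := by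
  rw [functional, tsum_eq_single 0]
  · simp [single]
  · intro n hn
    simp [single, Pi.single_eq_of_ne hn]

end

/-- The σ-weak (ultraweak) topology on `B(H)`: the coarsest topology for which all the
functionals `A ↦ ∑ₙ ⟨xₙ, A yₙ⟩` with `∑ₙ ‖xₙ‖² < ∞` and `∑ₙ ‖yₙ‖² < ∞` are continuous. -/
@[reducible]
def sigmaWeak (H : Type*) [NormedAddCommGroup H] [InnerProductSpace ℂ H] :
    TopologicalSpace (H →L[ℂ] H) :=
  TopologicalSpace.induced
    (fun (A : H →L[ℂ] H) (p : SquareSummablePair H) => p.functional A) inferInstance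

section

variable {H : Type*} [NormedAddCommGroup H] [InnerProductSpace ℂ H]

theorem tendsto_sigmaWeak_iff {ι : Type*} {l : Filter ι} {F : ι → H →L[ℂ] H} {A : H →L[ℂ] H} :
    Tendsto F l (@nhds _ (sigmaWeak H) A) ↔
      ∀ p : SquareSummablePair H, Tendsto (fun i => p.functional (F i)) l (𝓝 (p.functional A)) := by
  rw [sigmaWeak, nhds_induced, tendsto_comap_iff, tendsto_pi_nhds]
  rfl

theorem sigmaWeak_limit_unique {ι : Type*} {l : Filter ι} [l.NeBot] {F : ι → H →L[ℂ] H}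
    {A B : H →L[ℂ] H} (hA : Tendsto F l (@nhds _ (sigmaWeak H) A))
    (hB : Tendsto F l (@nhds _ (sigmaWeak H) B)) : A = B := by
  rw [tendsto_sigmaWeak_iff] at hA hB
  ext y
  refine ext_inner_left ℂ fun x => ?_
  simpa only [SquareSummablePair.functional_single] using
    tendsto_nhds_unique (hA (.single x y)) (hB (.single x y))

end

/-- A quantum Markov semigroup on `B(H)`. -/
structure QuantumMarkovSemigroup (H : Type*) [NormedAddCommGroup H] [InnerProductSpace ℂ H]
    [CompleteSpace H] where
  /-- The completely positive linear maps `T_t : B(H) → B(H)`, `t ≥ 0`. -/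
  T : ℝ≥0 → (H →L[ℂ] H) →CP (H →L[ℂ] H)
  continuous_map : ∀ t, @Continuous _ _ (sigmaWeak H) (sigmaWeak H) (T t)
  map_zero : ∀ A, T 0 A = A
  map_add : ∀ t s A, T (t + s) A = T t (T s A)
  continuous_orbit : ∀ A, @Continuous _ _ inferInstance (sigmaWeak H) fun t => T t A
  map_one : ∀ t, T t 1 = 1

namespace QuantumMarkovSemigroup

variable {H : Type*} [NormedAddCommGroup H] [InnerProductSpace ℂ H] [CompleteSpace H]

/-- The difference quotient `(T_t A - A) / t`. -/
def quotient (S : QuantumMarkovSemigroup H) (A : H →L[ℂ] H) (t : ℝ≥0) : H →L[ℂ] H :=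
  ((t : ℝ) : ℂ)⁻¹ • (S.T t A - A)

/-- `A` is in the domain of the generator, with value `B` there: `(T_t A - A) / t → B` σ-weakly
as `t → 0⁺`. -/
def GeneratesAt (S : QuantumMarkovSemigroup H) (A B : H →L[ℂ] H) : Prop :=
  Tendsto (S.quotient A) (𝓝[>] 0) (@nhds _ (sigmaWeak H) B)

theorem GeneratesAt.unique {S : QuantumMarkovSemigroup H} {A B C : H →L[ℂ] H}
    (hB : S.GeneratesAt A B) (hC : S.GeneratesAt A C) : B = C :=
  sigmaWeak_limit_unique hB hC

theorem GeneratesAt.add {S : QuantumMarkovSemigroup H} {A A' B B' : H →L[ℂ] H}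
    (h : S.GeneratesAt A B) (h' : S.GeneratesAt A' B') : S.GeneratesAt (A + A') (B + B') := by
  unfold GeneratesAt at *
  rw [tendsto_sigmaWeak_iff] at *
  intro p
  rw [p.functional_add]
  refine ((h p).add (h' p)).congr fun t => ?_
  rw [← p.functional_add]
  congr 1
  simp only [quotient, _root_.map_add, ← smul_add]
  congr 1
  abel

theorem GeneratesAt.smul {S : QuantumMarkovSemigroup H} {A B : H →L[ℂ] H} (c : ℂ)
    (h : S.GeneratesAt A B) : S.GeneratesAt (c • A) (c • B) := by
  unfold GeneratesAt at *
  rw [tendsto_sigmaWeak_iff] at *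
  intro p
  rw [p.functional_smul]
  refine ((h p).const_mul c).congr fun t => ?_
  rw [← p.functional_smul]
  congr 1
  simp only [quotient, map_smul, ← smul_sub, smul_comm c]

/-- The domain `D(L)`: all `A` for which `(T_t A - A) / t` converges σ-weakly as `t → 0⁺`. -/
def domain (S : QuantumMarkovSemigroup H) : Submodule ℂ (H →L[ℂ] H) where
  carrier := {A | ∃ B, S.GeneratesAt A B}
  add_mem' := fun ⟨_, h⟩ ⟨_, h'⟩ => ⟨_, h.add h'⟩
  zero_mem' := ⟨0, by
    unfold GeneratesAt
    rw [tendsto_sigmaWeak_iff]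
    intro p
    simp [quotient]⟩
  smul_mem' := fun c _ ⟨_, h⟩ => ⟨_, h.smul c⟩

/-- The infinitesimal generator `L`: `L A` is the σ-weak limit of `(T_t A - A) / t` as
`t → 0⁺`, for `A ∈ D(L)`. -/
def generator (S : QuantumMarkovSemigroup H) : S.domain →ₗ[ℂ] (H →L[ℂ] H) where
  toFun A := A.2.choose
  map_add' A B := (A + B).2.choose_spec.unique (A.2.choose_spec.add B.2.choose_spec)
  map_smul' c A := (c • A).2.choose_spec.unique (A.2.choose_spec.smul c)

theorem generator_spec (S : QuantumMarkovSemigroup H) (A : S.domain) :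
    S.GeneratesAt A (S.generator A) :=
  A.2.choose_spec

end QuantumMarkovSemigroup

/-- Let `𝒜` be a linear subspace of `B(H)` and `U` a linear subspace of `H`. A linear map `φ` from
`𝒜` to the sesquilinear forms on `U × U` (conjugate linear in the first variable) is
`U`-completely positive if `∑ i j, φ(A i j)(u i, u j) ≥ 0` for every `k × k` matrix `A` with
entries in `𝒜` that is a positive element of `M_k(B(H))`, and all `u i ∈ U`. -/
def IsUCompletelyPositive {H : Type*} [NormedAddCommGroup H] [InnerProductSpace ℂ H]
    [CompleteSpace H] {𝒜 : Submodule ℂ (H →L[ℂ] H)} {U : Submodule ℂ H}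
    (φ : 𝒜 →ₗ[ℂ] (U →ₗ⋆[ℂ] U →ₗ[ℂ] ℂ)) : Prop :=
  ∀ (k : ℕ) (A : Matrix (Fin k) (Fin k) 𝒜),
    0 ≤ CStarMatrix.ofMatrix (A.map fun a => (a : H →L[ℂ] H)) →
      ∀ u : Fin k → U, 0 ≤ ∑ i, ∑ j, φ (A i j) (u i) (u j)

/-- `T` is a nonzero positive finite rank operator and `h` is an associate vector of it: for some
spectral decomposition `T = ∑ₛ tₛ |kₛ⟩⟨kₛ|` with `kₛ` orthonormal and `tₛ > 0`, one has
`h = (∑ₛ tₛ)^(-1/2) ∑ₛ kₛ`. (With `k'ₛ = √(tr T) kₛ` this is `h = ∑ₛ k'ₛ / ‖k'ₛ‖²`.) -/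
def IsAssociateVector {H : Type*} [NormedAddCommGroup H] [InnerProductSpace ℂ H]
    (T : H →L[ℂ] H) (h : H) : Prop :=
  T ≠ 0 ∧ ∃ (m : ℕ) (k : Fin m → H) (t : Fin m → ℝ), Orthonormal ℂ k ∧ (∀ s, 0 < t s) ∧
    T = ∑ s, (t s : ℂ) • InnerProductSpace.rankOne ℂ (k s) (k s) ∧
    h = ((√(∑ s, t s) : ℝ) : ℂ)⁻¹ • ∑ s, k s

/-- `Lε = L (1 - ε L)⁻¹`: the map `1 - ε L` is a bijection of `D(L)` onto `B(H)`, and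
`Lε ((1 - ε L) B) = L B` for all `B ∈ D(L)`. -/
def IsYosidaApproximation {H : Type*} [NormedAddCommGroup H] [InnerProductSpace ℂ H]
    {D : Submodule ℂ (H →L[ℂ] H)} (L : D →ₗ[ℂ] (H →L[ℂ] H)) (ε : ℝ)
    (Lε : (H →L[ℂ] H) →L[ℂ] (H →L[ℂ] H)) : Prop :=
  Function.Bijective (fun B : D => (B : H →L[ℂ] H) - (ε : ℂ) • L B) ∧
    ∀ B : D, Lε ((B : H →L[ℂ] H) - (ε : ℂ) • L B) = L B

end

/-!
The resolvent `(1 - ε L)⁻¹` is the average `∫₀^∞ e⁻ˢ T_{εs} ds` of the semigroup over an exponential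
time, hence completely positive, and so the Yosida approximation `L_ε = ε⁻¹ ((1 - ε L)⁻¹ - 1)` is
bounded, Hermitian and conditionally completely positive. By the argument of Christensen and Evans,
`A ↦ L_ε A - G_ε A - A G_ε⋆` is completely positive: with `T = ∑ₛ |aₛ⟩⟨aₛ|` and `w = ∑ᵢ Bᵢ uᵢ`,
conditional complete positivity is applied, for each `s`, to the operators `-|w⟩⟨aₛ|, ⟨aₛ, h⟩ Bᵢ` at
the vectors `h, uᵢ`, and the resulting inequalities are added up; here `⟨h, T h⟩ = 1`. Since `L_ε A`
tends weakly to `L A` for `A ∈ D(L)`, these positive forms converge as `ε → 0⁺` on the vectors at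
which `G_ε⋆` converges weakly.
-/

noncomputable section

open MeasureTheory ProbabilityTheory Set

/-! ### Integration against the standard exponential law -/

section ExponentialLaw

variable {E : Type*} [NormedAddCommGroup E] [NormedSpace ℝ E] {f : ℝ → E} {C : ℝ}

instance isProbabilityMeasure_expMeasure_one : IsProbabilityMeasure (expMeasure 1) :=
  isProbabilityMeasure_expMeasure one_pos

theorem integral_expMeasure_one (f : ℝ → E) :
    ∫ s, f s ∂expMeasure 1 = ∫ s in Ioi 0, Real.exp (-s) • f s := by
  have hIci : (fun s => (gammaPDF 1 1 s).toReal • f s) =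
      (Ici 0).indicator fun s => Real.exp (-s) • f s := by
    ext s
    by_cases hs : 0 ≤ s
    · rw [indicator_of_mem (mem_Ici.2 hs), gammaPDF, ENNReal.toReal_ofReal
        (gammaPDFReal_nonneg one_pos one_pos s)]
      simp [gammaPDFReal, hs]
    · rw [indicator_of_notMem (by simpa using hs), gammaPDF_of_neg (not_le.1 hs)]
      simp
  have hmeas : Measurable (gammaPDF 1 1) := (measurable_gammaPDFReal 1 1).ennreal_ofReal
  rw [expMeasure, gammaMeasure, integral_withDensity_eq_integral_toReal_smul hmeas
    (.of_forall fun _ => ENNReal.ofReal_lt_top),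
    hIci, integral_indicator measurableSet_Ici, integral_Ici_eq_integral_Ioi]

theorem ae_nonneg_expMeasure_one : ∀ᵐ s ∂expMeasure 1, 0 ≤ s := by
  have hIio : expMeasure 1 (Iio 0) = 0 := by
    rw [expMeasure, gammaMeasure, withDensity_apply _ measurableSet_Iio]
    exact lintegral_gammaPDF_of_nonpos le_rfl
  simpa only [ae_iff, not_le] using! hIio

theorem integrableOn_exp_neg_smul (hf : Continuous f) (hC : ∀ s, ‖f s‖ ≤ C) (a : ℝ) :
    IntegrableOn (fun s => Real.exp (-s) • f s) (Ioi a) :=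
  (integrableOn_exp_neg_Ioi a).smul_bdd C hf.aestronglyMeasurable (.of_forall hC)

theorem tendsto_integral_comp_mul_expMeasure_one [CompleteSpace E] (hf : Continuous f)
    (hC : ∀ s, ‖f s‖ ≤ C) :
    Tendsto (fun ε => ∫ s, f (ε * s) ∂expMeasure 1) (𝓝 0) (𝓝 (f 0)) := by
  have hlim : Tendsto (fun ε => ∫ s, f (ε * s) ∂expMeasure 1) (𝓝 0)
      (𝓝 (∫ _, f 0 ∂expMeasure 1)) := by
    refine tendsto_integral_filter_of_dominated_convergence (fun _ => C)
      (.of_forall fun ε => (hf.comp (continuous_const_mul ε)).aestronglyMeasurable)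
      (.of_forall fun ε => .of_forall fun s => hC _) (integrable_const C) (.of_forall fun s => ?_)
    simpa [Function.comp_def] using (hf.comp (continuous_mul_const s)).tendsto 0
  simpa using hlim

theorem integral_add_expMeasure_one (hf : Continuous f) (hC : ∀ s, ‖f s‖ ≤ C) (r : ℝ) :
    ∫ s, f (r + s) ∂expMeasure 1 = Real.exp r •
      ((∫ s, f s ∂expMeasure 1) - ∫ s in (0 : ℝ)..r, Real.exp (-s) • f s) := by
  have hshift : ∀ s, Real.exp (-s) • f (r + s) =
      Real.exp r • (fun s => Real.exp (-s) • f s) (s + r) := fun s => by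
    rw [smul_smul, ← Real.exp_add, add_comm r s]
    ring_nf
  rw [integral_expMeasure_one, integral_expMeasure_one,
    ← intervalIntegral.integral_interval_add_Ioi (integrableOn_exp_neg_smul hf hC 0)
      (integrableOn_exp_neg_smul hf hC r), add_sub_cancel_left]
  simp_rw [hshift]
  rw [integral_smul]
  congr 1
  simpa using (measurePreserving_add_right volume r).setIntegral_preimage_emb
    (measurableEmbedding_addRight r) (fun s => Real.exp (-s) • f s) (Ioi r)

theorem hasDerivAt_integral_add_expMeasure_one [CompleteSpace E] (hf : Continuous f)
    (hC : ∀ s, ‖f s‖ ≤ C) :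
    HasDerivAt (fun r => ∫ s, f (r + s) ∂expMeasure 1) ((∫ s, f s ∂expMeasure 1) - f 0) 0 := by
  have hcont : Continuous fun s => Real.exp (-s) • f s := by fun_prop
  have hint : HasDerivAt (fun r => ∫ s in (0 : ℝ)..r, Real.exp (-s) • f s) (f 0) 0 := by
    simpa using (hcont.integral_hasStrictDerivAt 0 0).hasDerivAt
  have hprod := (Real.hasDerivAt_exp 0).smul (hint.const_sub (∫ s, f s ∂expMeasure 1))
  simp only [funext (integral_add_expMeasure_one hf hC)]
  refine hprod.congr_deriv ?_
  simp [sub_eq_neg_add]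

/-- Dynkin's formula at an exponential time. -/
theorem integral_deriv_expMeasure_one [CompleteSpace E] {f' : ℝ → E} {C' : ℝ}
    (hf : Continuous f) (hC : ∀ s, ‖f s‖ ≤ C) (hf' : Continuous f') (hC' : ∀ s, ‖f' s‖ ≤ C')
    (hderiv : ∀ s, 0 < s → HasDerivWithinAt f (f' s) (Ioi s) s) :
    ∫ s, f' s ∂expMeasure 1 = (∫ s, f s ∂expMeasure 1) - f 0 := by
  have hexp : ∀ s, HasDerivAt (fun s => Real.exp (-s)) (-Real.exp (-s)) s := fun s => by
    simpa using (hasDerivAt_neg s).exp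
  have hpart : ∀ r, 0 ≤ r → ∫ s in (0 : ℝ)..r, (Real.exp (-s) • f' s - Real.exp (-s) • f s) =
      Real.exp (-r) • f r - f 0 := fun r hr => by
    have hcont : Continuous fun s => Real.exp (-s) • f s := by fun_prop
    have hcont' : Continuous fun s => Real.exp (-s) • f' s - Real.exp (-s) • f s := by fun_prop
    rw [intervalIntegral.integral_eq_sub_of_hasDeriv_right_of_le hr hcont.continuousOn
      (fun s hs => ?_) (hcont'.intervalIntegrable 0 r)]
    · simp
    · refine ((hexp s).hasDerivWithinAt.smul (hderiv s hs.1)).congr_deriv ?_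
      simp [sub_eq_add_neg]
  have hdecay : Tendsto (fun r => Real.exp (-r) • f r - f 0) atTop (𝓝 (0 - f 0)) :=
    (NormedField.tendsto_zero_smul_of_tendsto_zero_of_bounded
      Real.tendsto_exp_neg_atTop_nhds_zero
      (isBoundedUnder_of ⟨C, hC⟩)).sub_const _
  have hi := integrableOn_exp_neg_smul hf hC 0
  have hi' := integrableOn_exp_neg_smul hf' hC' 0
  have heq := tendsto_nhds_unique
    (intervalIntegral_tendsto_integral_Ioi 0 (hi'.sub hi) tendsto_id)
    (hdecay.congr' ((eventually_ge_atTop 0).mono fun r hr => (hpart r hr).symm))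
  simp only [Pi.sub_apply, integral_sub hi' hi, ← integral_expMeasure_one] at heq
  rw [sub_eq_iff_eq_add.1 heq]
  abel

end ExponentialLaw

/-! ### σ-weak integrals -/

section SigmaWeak

variable {H : Type*} [NormedAddCommGroup H] [InnerProductSpace ℂ H]

namespace SquareSummablePair

variable (p : SquareSummablePair H) (A : H →L[ℂ] H)

theorem norm_inner_apply_le (n : ℕ) :
    ‖⟪p.left n, A (p.right n)⟫_ℂ‖ ≤ (‖p.left n‖ ^ 2 + ‖p.right n‖ ^ 2) * ‖A‖ :=
  calc ‖⟪p.left n, A (p.right n)⟫_ℂ‖ ≤ ‖p.left n‖ * (‖A‖ * ‖p.right n‖) :=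
        (norm_inner_le_norm _ _).trans (by gcongr; exact A.le_opNorm _)
    _ = (‖p.left n‖ * ‖p.right n‖) * ‖A‖ := by ring
    _ ≤ (‖p.left n‖ ^ 2 + ‖p.right n‖ ^ 2) * ‖A‖ := by
        gcongr
        linarith [two_mul_le_add_sq ‖p.left n‖ ‖p.right n‖,
          mul_nonneg (norm_nonneg (p.left n)) (norm_nonneg (p.right n))]

/-- The functional of a square-summable pair as a norm-continuous linear functional. -/
def functionalCLM : (H →L[ℂ] H) →L[ℂ] ℂ :=
  LinearMap.mkContinuous ⟨⟨p.functional, p.functional_add⟩, p.functional_smul⟩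
    (∑' n, (‖p.left n‖ ^ 2 + ‖p.right n‖ ^ 2)) fun A => by
      have hs := (p.summable_left.add p.summable_right).mul_right ‖A‖
      rw [← tsum_mul_right]
      exact tsum_of_norm_bounded hs.hasSum (p.norm_inner_apply_le A)

theorem functional_sub (B : H →L[ℂ] H) :
    p.functional (A - B) = p.functional A - p.functional B :=
  p.functionalCLM.map_sub A B

theorem continuous_functional : @Continuous _ _ (sigmaWeak H) _ p.functional := by
  let := sigmaWeak H
  have h : Continuous fun (A : H →L[ℂ] H) (p : SquareSummablePair H) => p.functional A :=
    continuous_induced_dom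
  exact (continuous_pi_iff.1 h p :)

/-- The pair representing the adjoint trace-class operator. -/
def swap : SquareSummablePair H := ⟨p.right, p.left, p.summable_right, p.summable_left⟩

theorem functional_star [CompleteSpace H] : p.functional (star A) = star (p.swap.functional A) := by
  rw [functional, functional, tsum_star]
  refine tsum_congr fun n => ?_
  rw [ContinuousLinearMap.star_eq_adjoint, ContinuousLinearMap.adjoint_inner_right]
  exact (inner_conj_symm _ _).symm

end SquareSummablePair

theorem mem_span_functionalCLM_of_continuous_sigmaWeak {φ : (H →L[ℂ] H) →ₗ[ℂ] ℂ}
    (hφ : @Continuous _ _ (sigmaWeak H) _ φ) :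
    φ ∈ Submodule.span ℂ
      (range fun p : SquareSummablePair H => (p.functionalCLM : (H →L[ℂ] H) →ₗ[ℂ] ℂ)) := by
  rw [LinearMap.mem_span_iff_continuous]
  convert hφ
  rw [sigmaWeak, Pi.topologicalSpace, induced_iInf]
  simp only [induced_compose]
  rfl

variable {α : Type*} [MeasurableSpace α] {μ : Measure α} {f g : α → H →L[ℂ] H} {A B : H →L[ℂ] H}

/-- `B` is the integral of `f` in the σ-weak sense: `B` and `f` are matched by integrating against
the functionals which define the σ-weak topology. As `f` need not be strongly measurable in norm,
its Bochner integral may be the junk value `0`. -/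
def HasSigmaWeakIntegral (f : α → H →L[ℂ] H) (μ : Measure α) (B : H →L[ℂ] H) : Prop :=
  ∀ p : SquareSummablePair H,
    Integrable (fun s => p.functional (f s)) μ ∧ ∫ s, p.functional (f s) ∂μ = p.functional B

namespace HasSigmaWeakIntegral

theorem integrable_inner (hA : HasSigmaWeakIntegral f μ A) (x y : H) :
    Integrable (fun s => ⟪x, f s y⟫_ℂ) μ := by
  simpa only [SquareSummablePair.functional_single] using (hA (.single x y)).1

theorem integral_inner (hA : HasSigmaWeakIntegral f μ A) (x y : H) :
    ∫ s, ⟪x, f s y⟫_ℂ ∂μ = ⟪x, A y⟫_ℂ := by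
  simpa only [SquareSummablePair.functional_single] using (hA (.single x y)).2

theorem unique (hA : HasSigmaWeakIntegral f μ A) (hB : HasSigmaWeakIntegral f μ B) : A = B := by
  ext y
  refine ext_inner_left ℂ fun x => ?_
  rw [← hA.integral_inner, hB.integral_inner]

theorem add (hA : HasSigmaWeakIntegral f μ A) (hB : HasSigmaWeakIntegral g μ B) :
    HasSigmaWeakIntegral (fun s => f s + g s) μ (A + B) := fun p => by
  simp only [p.functional_add]
  exact ⟨(hA p).1.add (hB p).1, by rw [integral_add (hA p).1 (hB p).1, (hA p).2, (hB p).2]⟩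

theorem const_smul (c : ℂ) (hA : HasSigmaWeakIntegral f μ A) :
    HasSigmaWeakIntegral (fun s => c • f s) μ (c • A) := fun p => by
  simp only [p.functional_smul]
  exact ⟨(hA p).1.const_mul c, by rw [integral_const_mul, (hA p).2]⟩

theorem integral_apply_of_continuous (hA : HasSigmaWeakIntegral f μ A)
    {φ : (H →L[ℂ] H) →ₗ[ℂ] ℂ} (hφ : @Continuous _ _ (sigmaWeak H) _ φ) :
    Integrable (fun s => φ (f s)) μ ∧ ∫ s, φ (f s) ∂μ = φ A := by
  have hspan := mem_span_functionalCLM_of_continuous_sigmaWeak hφ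
  clear hφ
  induction hspan using Submodule.span_induction with
  | mem φ h => obtain ⟨p, rfl⟩ := h; exact hA p
  | zero => simp
  | add φ ψ _ _ hφ hψ =>
    simp only [LinearMap.add_apply]
    exact ⟨hφ.1.add hψ.1, by rw [integral_add hφ.1 hψ.1, hφ.2, hψ.2]⟩
  | smul c φ _ hφ =>
    simp only [LinearMap.smul_apply, smul_eq_mul]
    exact ⟨hφ.1.const_mul c, by rw [integral_const_mul, hφ.2]⟩

theorem map (hA : HasSigmaWeakIntegral f μ A) {Φ : (H →L[ℂ] H) →ₗ[ℂ] (H →L[ℂ] H)}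
    (hΦ : @Continuous _ _ (sigmaWeak H) (sigmaWeak H) Φ) :
    HasSigmaWeakIntegral (fun s => Φ (f s)) μ (Φ A) := fun p =>
  hA.integral_apply_of_continuous (φ := (p.functionalCLM : (H →L[ℂ] H) →ₗ[ℂ] ℂ) ∘ₗ Φ)
    (@Continuous.comp _ _ _ (sigmaWeak H) (sigmaWeak H) _ _ p.functional p.continuous_functional hΦ)

theorem norm_le (hA : HasSigmaWeakIntegral f μ A) {b : α → ℝ} (hb : Integrable b μ)
    (hfb : ∀ s, ‖f s‖ ≤ b s) : ‖A‖ ≤ ∫ s, b s ∂μ := by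
  refine A.opNorm_le_of_re_inner_le
    (integral_nonneg fun s => (norm_nonneg _).trans (hfb s)) fun x y hx hy => ?_
  calc RCLike.re ⟪A x, y⟫_ℂ = RCLike.re ⟪y, A x⟫_ℂ := inner_re_symm _ _
    _ ≤ ‖⟪y, A x⟫_ℂ‖ := RCLike.re_le_norm _
    _ = ‖∫ s, ⟪y, f s x⟫_ℂ ∂μ‖ := by rw [hA.integral_inner]
    _ ≤ ∫ s, b s ∂μ := norm_integral_le_of_norm_le hb (.of_forall fun s =>
        (norm_inner_le_norm _ _).trans <| by
          simpa [hx, hy] using (f s).le_of_opNorm_le (hfb s) x)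

theorem sum_sum_inner_nonneg {n : Type*} [Fintype n] {f : n → n → α → H →L[ℂ] H}
    {A : n → n → H →L[ℂ] H} (hA : ∀ i j, HasSigmaWeakIntegral (f i j) μ (A i j)) {u : n → H}
    (hf : ∀ s, 0 ≤ ∑ i, ∑ j, ⟪u i, f i j s (u j)⟫_ℂ) : 0 ≤ ∑ i, ∑ j, ⟪u i, A i j (u j)⟫_ℂ := by
  have hi := fun i j => (hA i j).integrable_inner (u i) (u j)
  simp only [← (hA _ _).integral_inner]
  simp_rw [← integral_finsetSum _ fun j _ => hi _ j]
  rw [← integral_finsetSum _ fun i _ => integrable_finsetSum _ fun j _ => hi i j]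
  exact integral_nonneg_of_ae (.of_forall hf)

protected theorem star [CompleteSpace H] (hA : HasSigmaWeakIntegral f μ A) :
    HasSigmaWeakIntegral (fun s => star (f s)) μ (star A) := fun p => by
  simp only [p.functional_star, ← (hA p.swap).2]
  exact ⟨(starL' ℝ : ℂ ≃L[ℝ] ℂ).integrable_comp_iff.2 (hA p.swap).1, integral_conj⟩

end HasSigmaWeakIntegral

variable [CompleteSpace H]

theorem exists_inner_apply_eq_integral {b : α → ℝ} (hb : Integrable b μ)
    (hfb : ∀ s, ‖f s‖ ≤ b s) (hf : ∀ x y, Integrable (fun s => ⟪x, f s y⟫_ℂ) μ) :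
    ∃ B : H →L[ℂ] H, ∀ x y, ⟪x, B y⟫_ℂ = ∫ s, ⟪x, f s y⟫_ℂ ∂μ := by
  have hle : ∀ x y s, ‖⟪x, f s y⟫_ℂ‖ ≤ b s * (‖x‖ * ‖y‖) := fun x y s =>
    calc ‖⟪x, f s y⟫_ℂ‖ ≤ ‖x‖ * (b s * ‖y‖) :=
          (norm_inner_le_norm _ _).trans (by gcongr; exact (f s).le_of_opNorm_le (hfb s) y)
      _ = b s * (‖x‖ * ‖y‖) := by ring
  let form : H →ₗ⋆[ℂ] H →ₗ[ℂ] ℂ := LinearMap.mk₂'ₛₗ (starRingEnd ℂ) (RingHom.id ℂ)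
    (fun x y => ∫ s, ⟪x, f s y⟫_ℂ ∂μ)
    (fun x x' y => by simp only [inner_add_left]; exact integral_add (hf x y) (hf x' y))
    (fun c x y => by simp only [inner_smul_left]; exact integral_const_mul _ _)
    (fun x y y' => by simp only [map_add, inner_add_right]; exact integral_add (hf x y) (hf x y'))
    (fun c x y => by simp only [map_smul, inner_smul_right]; exact integral_const_mul _ _)
  have hform : ∀ x y, ‖form x y‖ ≤ (∫ s, b s ∂μ) * ‖x‖ * ‖y‖ := fun x y => by
    rw [mul_assoc, ← integral_mul_const]
    exact norm_integral_le_of_norm_le (hb.mul_const _) (.of_forall (hle x y))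
  refine ⟨ContinuousLinearMap.adjoint
    (InnerProductSpace.continuousLinearMapOfBilin (form.mkContinuous₂ _ hform)), fun x y => ?_⟩
  rw [ContinuousLinearMap.adjoint_inner_right, InnerProductSpace.continuousLinearMapOfBilin_apply]
  rfl

theorem exists_hasSigmaWeakIntegral {b : α → ℝ} (hb : Integrable b μ) (hfb : ∀ s, ‖f s‖ ≤ b s)
    (hf : ∀ p : SquareSummablePair H, AEStronglyMeasurable (fun s => p.functional (f s)) μ) :
    ∃ B, HasSigmaWeakIntegral f μ B := by
  have hp : ∀ p : SquareSummablePair H, Integrable (fun s => p.functional (f s)) μ := fun p =>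
    (hb.const_mul _).mono' (hf p) (.of_forall fun s => p.functionalCLM.le_of_opNorm_le_of_le
      le_rfl (hfb s))
  have hi : ∀ x y, Integrable (fun s => ⟪x, f s y⟫_ℂ) μ := fun x y => by
    simpa only [SquareSummablePair.functional_single] using hp (.single x y)
  obtain ⟨B, hB⟩ := exists_inner_apply_eq_integral hb hfb hi
  refine ⟨B, fun p => ⟨hp p, ?_⟩⟩
  have hterm : ∀ n s, ‖⟪p.left n, f s (p.right n)⟫_ℂ‖ ≤ (‖p.left n‖ ^ 2 + ‖p.right n‖ ^ 2) * b s :=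
    fun n s => (p.norm_inner_apply_le (f s) n).trans (by gcongr; exact hfb s)
  have hsum : Summable fun n => ∫ s, ‖⟪p.left n, f s (p.right n)⟫_ℂ‖ ∂μ :=
    Summable.of_nonneg_of_le (fun n => by positivity)
      (fun n => integral_mono (hi _ _).norm (hb.const_mul _) (hterm n))
      (by simpa only [integral_const_mul] using
        (p.summable_left.add p.summable_right).mul_right (∫ s, b s ∂μ))
  simp only [SquareSummablePair.functional, hB]
  exact (hasSum_integral_of_summable_integral_norm (fun n => hi _ _) hsum).tsum_eq.symm

end SigmaWeak

/-! ### The resolvent and the Yosida approximations -/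

theorem norm_map_le_of_orderHomClass {F A B : Type*} [CStarAlgebra A] [PartialOrder A]
    [StarOrderedRing A] [CStarAlgebra B] [PartialOrder B] [StarOrderedRing B] [FunLike F A B]
    [LinearMapClass F ℂ A B] [OrderHomClass F A B] (φ : F) (a : A) :
    ‖φ a‖ ≤ 4 * (‖φ 1‖ * ‖a‖) := by
  obtain ⟨x, hx, hxa, ha⟩ := CStarAlgebra.exists_sum_four_nonneg a
  have hφx : ∀ i, ‖φ (x i)‖ ≤ ‖φ 1‖ * ‖a‖ := fun i =>
    ((PositiveLinearMap.ofClass φ).norm_apply_le_of_nonneg (x i) (hx i)).trans <| by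
      simpa using! mul_le_mul_of_nonneg_left (hxa i) (norm_nonneg (φ 1))
  calc ‖φ a‖ = ‖∑ i : Fin 4, Complex.I ^ (i : ℕ) • φ (x i)‖ := by
        conv_lhs => rw [ha]
        simp only [map_sum, map_smul]
    _ ≤ ∑ _i : Fin 4, ‖φ 1‖ * ‖a‖ := norm_sum_le_of_le _ fun i _ => by
        simpa [norm_smul] using hφx i
    _ = 4 * (‖φ 1‖ * ‖a‖) := by simp

namespace QuantumMarkovSemigroup

variable {H : Type*} [NormedAddCommGroup H] [InnerProductSpace ℂ H] [CompleteSpace H]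
  (S : QuantumMarkovSemigroup H)

theorem norm_T_apply_le (t : ℝ≥0) (A : H →L[ℂ] H) : ‖S.T t A‖ ≤ 4 * ‖A‖ := by
  refine (norm_map_le_of_orderHomClass (S.T t) A).trans ?_
  rw [S.map_one]
  gcongr
  exact mul_le_of_le_one_left (norm_nonneg A) ContinuousLinearMap.norm_id_le

theorem continuous_functional_orbit (p : SquareSummablePair H) (A : H →L[ℂ] H) :
    Continuous fun r : ℝ => p.functional (S.T r.toNNReal A) := by
  have hp := @Continuous.comp _ _ _ _ (sigmaWeak H) _ _ _ p.continuous_functional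
    (S.continuous_orbit A)
  exact hp.comp continuous_real_toNNReal

theorem norm_functional_orbit_le (p : SquareSummablePair H) (A : H →L[ℂ] H) (t : ℝ≥0) :
    ‖p.functional (S.T t A)‖ ≤ ‖p.functionalCLM‖ * (4 * ‖A‖) :=
  p.functionalCLM.le_of_opNorm_le_of_le le_rfl (S.norm_T_apply_le t A)

theorem functional_T_quotient (p : SquareSummablePair H) (A : H →L[ℂ] H) (r t : ℝ≥0) :
    p.functional (S.T r (S.quotient A t)) =
      (t : ℝ)⁻¹ • (p.functional (S.T (r + t) A) - p.functional (S.T r A)) := by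
  simp only [quotient, map_smul, map_sub, p.functional_smul, ← S.map_add, Complex.real_smul,
    Complex.ofReal_inv, p.functional_sub]

variable {S} in
theorem GeneratesAt.hasDerivWithinAt {A B : H →L[ℂ] H} (h : S.GeneratesAt A B)
    (p : SquareSummablePair H) {r : ℝ} (hr : 0 ≤ r) :
    HasDerivWithinAt (fun r : ℝ => p.functional (S.T r.toNNReal A))
      (p.functional (S.T r.toNNReal B)) (Ioi r) r := by
  rw [hasDerivWithinAt_iff_tendsto_slope' self_notMem_Ioi]
  have hquot : Tendsto (fun t => p.functional (S.T r.toNNReal (S.quotient A t))) (𝓝[>] 0)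
      (𝓝 (p.functional (S.T r.toNNReal B))) := by
    let := sigmaWeak H
    exact ((p.continuous_functional.comp (S.continuous_map r.toNNReal)).tendsto B).comp h
  have hsub : Tendsto (fun x => (x - r).toNNReal) (𝓝[>] r) (𝓝[>] 0) := by
    refine tendsto_nhdsWithin_iff.2 ⟨?_, eventually_nhdsWithin_of_forall fun x (hx : r < x) =>
      Real.toNNReal_pos.2 (sub_pos.2 hx)⟩
    have hcont : Continuous fun x => (x - r).toNNReal := by fun_prop
    simpa using (hcont.tendsto r).mono_left nhdsWithin_le_nhds
  refine (hquot.comp hsub).congr' (eventually_nhdsWithin_of_forall fun x (hx : r < x) => ?_)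
  have hxr := sub_nonneg.2 hx.le
  rw [Function.comp_apply, functional_T_quotient, ← Real.toNNReal_add hr hxr, add_sub_cancel,
    Real.coe_toNNReal _ hxr, slope_def_module]

theorem exists_hasSigmaWeakIntegral_orbit (ε : ℝ) (A : H →L[ℂ] H) :
    ∃ B, HasSigmaWeakIntegral (fun s => S.T (ε * s).toNNReal A) (expMeasure 1) B :=
  exists_hasSigmaWeakIntegral (integrable_const (4 * ‖A‖)) (fun _ => S.norm_T_apply_le _ A)
    fun p => ((S.continuous_functional_orbit p A).comp
      (continuous_const_mul ε)).aestronglyMeasurable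

/-- The resolvent `(1 - ε L)⁻¹` of the generator, as the σ-weak integral `∫₀^∞ e⁻ˢ T_{εs} ds`. -/
def resolvent (ε : ℝ) : (H →L[ℂ] H) →L[ℂ] (H →L[ℂ] H) :=
  have hR := fun A => (S.exists_hasSigmaWeakIntegral_orbit ε A).choose_spec
  LinearMap.mkContinuous
    { toFun := fun A => (S.exists_hasSigmaWeakIntegral_orbit ε A).choose
      map_add' := fun A B => (hR (A + B)).unique <| by
        simpa only [_root_.map_add] using (hR A).add (hR B)
      map_smul' := fun c A => (hR (c • A)).unique <| by
        simpa only [map_smul, RingHom.id_apply] using (hR A).const_smul c }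
    4 fun A => by
      simpa using (hR A).norm_le (integrable_const (4 * ‖A‖)) fun _ => S.norm_T_apply_le _ A

theorem hasSigmaWeakIntegral_resolvent (ε : ℝ) (A : H →L[ℂ] H) :
    HasSigmaWeakIntegral (fun s => S.T (ε * s).toNNReal A) (expMeasure 1) (S.resolvent ε A) :=
  (S.exists_hasSigmaWeakIntegral_orbit ε A).choose_spec

theorem resolvent_star (ε : ℝ) (A : H →L[ℂ] H) :
    S.resolvent ε (star A) = star (S.resolvent ε A) :=
  (S.hasSigmaWeakIntegral_resolvent ε (star A)).unique <| by
    simpa only [map_star] using (S.hasSigmaWeakIntegral_resolvent ε A).star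

theorem tendsto_functional_resolvent (p : SquareSummablePair H) (A : H →L[ℂ] H) :
    Tendsto (fun ε => p.functional (S.resolvent ε A)) (𝓝 0) (𝓝 (p.functional A)) := by
  have hlim := tendsto_integral_comp_mul_expMeasure_one (S.continuous_functional_orbit p A)
    fun r => S.norm_functional_orbit_le p A r.toNNReal
  simpa only [(S.hasSigmaWeakIntegral_resolvent _ A p).2, Real.toNNReal_zero, S.map_zero] using hlim

theorem functional_T_resolvent {ε : ℝ} (hε : 0 < ε) (p : SquareSummablePair H) (A : H →L[ℂ] H)
    (t : ℝ≥0) : p.functional (S.T t (S.resolvent ε A)) =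
      ∫ s, p.functional (S.T (ε * (ε⁻¹ * t + s)).toNNReal A) ∂expMeasure 1 := by
  have hmap := (S.hasSigmaWeakIntegral_resolvent ε A).map (Φ := (S.T t).toLinearMap)
    (S.continuous_map t)
  refine (hmap p).2.symm.trans <|
    integral_congr_ae (ae_nonneg_expMeasure_one.mono fun s hs => congrArg p.functional ?_)
  beta_reduce
  rw [mul_add, mul_inv_cancel_left₀ hε.ne', Real.toNNReal_add t.coe_nonneg (mul_nonneg hε.le hs),
    Real.toNNReal_coe, S.map_add]
  rfl

theorem generatesAt_resolvent {ε : ℝ} (hε : 0 < ε) (A : H →L[ℂ] H) :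
    S.GeneratesAt (S.resolvent ε A) ((ε : ℂ)⁻¹ • (S.resolvent ε A - A)) := by
  refine tendsto_sigmaWeak_iff.2 fun p => ?_
  have hderiv := hasDerivAt_integral_add_expMeasure_one
    ((S.continuous_functional_orbit p A).comp (continuous_const_mul ε))
    fun s => S.norm_functional_orbit_le p A (ε * s).toNNReal
  have hscaled := HasDerivAt.scomp_of_eq (0 : ℝ) hderiv (hasDerivAt_const_mul ε⁻¹)
    (mul_zero ε⁻¹).symm
  have hslope := hscaled.tendsto_slope_zero_right.comp (NNReal.map_coe_nhdsGT 0).le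
  convert hslope using 2 with t
  · have hzero := S.functional_T_resolvent hε p A 0
    have hquot := S.functional_T_quotient p (S.resolvent ε A) 0 t
    simp only [S.map_zero, zero_add] at hzero hquot
    simp only [hquot, hzero, S.functional_T_resolvent hε, Function.comp_apply, zero_add,
      NNReal.coe_zero]
  · simp only [Function.comp_apply, mul_zero, Real.toNNReal_zero, S.map_zero,
      (S.hasSigmaWeakIntegral_resolvent ε A p).2, p.functional_smul, p.functional_sub,
      Complex.real_smul, Complex.ofReal_inv]

theorem resolvent_sub_smul_generator {ε : ℝ} (hε : 0 < ε) (A : S.domain) :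
    S.resolvent ε ((A : H →L[ℂ] H) - (ε : ℂ) • S.generator A) = A := by
  have hdynkin (p : SquareSummablePair H) : ε * p.functional (S.resolvent ε (S.generator A)) =
      p.functional (S.resolvent ε A) - p.functional A := by
    have h := integral_deriv_expMeasure_one
      ((S.continuous_functional_orbit p A).comp (continuous_const_mul ε))
      (fun s => S.norm_functional_orbit_le p A (ε * s).toNNReal)
      (((S.continuous_functional_orbit p (S.generator A)).comp
        (continuous_const_mul ε)).const_smul ε)
      (fun s => (norm_smul_le _ _).trans <| mul_le_mul_of_nonneg_left
        (S.norm_functional_orbit_le p (S.generator A) (ε * s).toNNReal) (norm_nonneg ε))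
      fun s hs => HasDerivWithinAt.scomp s
        ((S.generator_spec A).hasDerivWithinAt p (mul_nonneg hε.le hs.le))
        (hasDerivAt_const_mul ε).hasDerivWithinAt fun x (hx : s < x) =>
          (mul_lt_mul_iff_of_pos_left hε).2 hx
    simp only [Function.comp_def, Pi.smul_apply, integral_smul,
      (S.hasSigmaWeakIntegral_resolvent ε _ p).2, mul_zero, Real.toNNReal_zero, S.map_zero] at h
    simpa using h
  ext y
  refine ext_inner_left ℂ fun x => ?_
  have hxy := hdynkin (.single x y)
  simp only [SquareSummablePair.functional_single] at hxy
  rw [map_sub, map_smul, sub_apply, smul_apply, inner_sub_right, inner_smul_right, hxy,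
    sub_sub_cancel]

theorem generator_mk {A B : H →L[ℂ] H} (h : S.GeneratesAt A B) : S.generator ⟨A, B, h⟩ = B :=
  (S.generator_spec ⟨A, B, h⟩).unique h

theorem bijective_sub_smul_generator {ε : ℝ} (hε : 0 < ε) :
    Function.Bijective fun A : S.domain => (A : H →L[ℂ] H) - (ε : ℂ) • S.generator A := by
  refine ⟨fun A B hAB => Subtype.ext ?_, fun A => ?_⟩
  · rw [← S.resolvent_sub_smul_generator hε A, ← S.resolvent_sub_smul_generator hε B]
    exact congrArg (S.resolvent ε) hAB
  · have hgen := S.generatesAt_resolvent hε A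
    refine ⟨⟨S.resolvent ε A, _, hgen⟩, ?_⟩
    beta_reduce
    rw [S.generator_mk hgen, smul_inv_smul₀ (Complex.ofReal_ne_zero.2 hε.ne'), sub_sub_cancel]

/-- The Yosida approximation `L (1 - ε L)⁻¹` of the generator, in the form
`ε⁻¹ ((1 - ε L)⁻¹ - 1)` which makes sense on all of `B(H)`. -/
def yosida (ε : ℝ) : (H →L[ℂ] H) →L[ℂ] (H →L[ℂ] H) :=
  (ε : ℂ)⁻¹ • (S.resolvent ε - ContinuousLinearMap.id ℂ _)

theorem yosida_apply (ε : ℝ) (A : H →L[ℂ] H) :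
    S.yosida ε A = (ε : ℂ)⁻¹ • (S.resolvent ε A - A) := rfl

theorem yosida_star (ε : ℝ) (A : H →L[ℂ] H) : S.yosida ε (star A) = star (S.yosida ε A) := by
  simp [yosida_apply, resolvent_star]

theorem yosida_eq_resolvent_generator {ε : ℝ} (hε : 0 < ε) (A : S.domain) :
    S.yosida ε A = S.resolvent ε (S.generator A) := by
  have h := S.resolvent_sub_smul_generator hε A
  rw [map_sub, map_smul, sub_eq_iff_eq_add] at h
  rw [yosida_apply, h, add_sub_cancel_left, inv_smul_smul₀ (Complex.ofReal_ne_zero.2 hε.ne')]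

theorem isYosidaApproximation_yosida {ε : ℝ} (hε : 0 < ε) :
    IsYosidaApproximation S.generator ε (S.yosida ε) := by
  refine ⟨S.bijective_sub_smul_generator hε, fun A => ?_⟩
  rw [yosida_apply, S.resolvent_sub_smul_generator hε, sub_sub_cancel,
    inv_smul_smul₀ (Complex.ofReal_ne_zero.2 hε.ne')]

theorem tendsto_inner_yosida (A : S.domain) (x y : H) :
    Tendsto (fun ε => ⟪x, S.yosida ε A y⟫_ℂ) (𝓝[>] 0) (𝓝 ⟪x, S.generator A y⟫_ℂ) := by
  have hlim := S.tendsto_functional_resolvent (.single x y) (S.generator A)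
  simp only [SquareSummablePair.functional_single] at hlim
  refine (hlim.mono_left nhdsWithin_le_nhds).congr' ?_
  filter_upwards [self_mem_nhdsWithin] with ε hε
  rw [S.yosida_eq_resolvent_generator hε]

end QuantumMarkovSemigroup

/-! ### Conditional complete positivity -/

section CompletePositivity

open ContinuousLinearMap InnerProductSpace

theorem cstarMatrix_star_mul_nonneg {n A : Type*} [Fintype n] [CStarAlgebra A] [PartialOrder A]
    [StarOrderedRing A] (b : n → A) :
    0 ≤ (CStarMatrix.ofMatrix fun i j => star (b i) * b j : CStarMatrix n n A) := by
  classical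
  rcases isEmpty_or_nonempty n with _ | ⟨⟨i₀⟩⟩
  · exact le_of_eq (CStarMatrix.ext fun i => isEmptyElim i)
  let row : CStarMatrix n n A := CStarMatrix.ofMatrix fun l i => if l = i₀ then b i else 0
  convert star_mul_self_nonneg row
  ext i j
  rw [CStarMatrix.mul_apply]
  change star (b i) * b j =
    ∑ l, star (if l = i₀ then b i else 0) * (if l = i₀ then b j else 0)
  simp

theorem exists_eq_star_mul_self_of_nonneg {A : Type*} [NonUnitalCStarAlgebra A] [PartialOrder A]
    [StarOrderedRing A] {a : A} (ha : 0 ≤ a) : ∃ b, a = star b * b :=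
  CStarAlgebra.nonneg_iff_eq_star_mul_self.1 ha

variable {H : Type*} [NormedAddCommGroup H] [InnerProductSpace ℂ H] [CompleteSpace H]

theorem sum_sum_inner_star_mul_apply {n : Type*} [Fintype n] (B : n → H →L[ℂ] H) (u : n → H) :
    ∑ i, ∑ j, ⟪u i, (star (B i) * B j) (u j)⟫_ℂ = ⟪∑ i, B i (u i), ∑ i, B i (u i)⟫_ℂ := by
  simp only [mul_apply_eq_comp, star_eq_adjoint, adjoint_inner_right, sum_inner, inner_sum]
  exact Finset.sum_comm

theorem sum_sum_inner_map_nonneg_of_star_mul {n : Type*} [Fintype n]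
    (Ψ : (H →L[ℂ] H) →ₗ[ℂ] (H →L[ℂ] H)) (u : n → H)
    (hΨ : ∀ B : n → H →L[ℂ] H, 0 ≤ ∑ i, ∑ j, ⟪u i, Ψ (star (B i) * B j) (u j)⟫_ℂ)
    {M : CStarMatrix n n (H →L[ℂ] H)} (hM : 0 ≤ M) : 0 ≤ ∑ i, ∑ j, ⟪u i, Ψ (M i j) (u j)⟫_ℂ := by
  obtain ⟨N, rfl⟩ := exists_eq_star_mul_self_of_nonneg hM
  calc 0 ≤ ∑ l, ∑ i, ∑ j, ⟪u i, Ψ (star (N l i) * N l j) (u j)⟫_ℂ :=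
        Finset.sum_nonneg fun l _ => hΨ (N l)
    _ = ∑ i, ∑ j, ∑ l, ⟪u i, Ψ (star (N l i) * N l j) (u j)⟫_ℂ := Finset.sum_comm_cycle.symm
    _ = ∑ i, ∑ j, ⟪u i, Ψ ((star N * N) i j) (u j)⟫_ℂ := by
        simp only [CStarMatrix.mul_apply, CStarMatrix.star_apply, map_sum, sum_apply, inner_sum]

theorem sum_sum_inner_nonneg_of_cstarMatrix_nonneg {n : Type*} [Fintype n]
    {M : CStarMatrix n n (H →L[ℂ] H)} (hM : 0 ≤ M) (u : n → H) :
    0 ≤ ∑ i, ∑ j, ⟪u i, M i j (u j)⟫_ℂ :=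
  sum_sum_inner_map_nonneg_of_star_mul LinearMap.id u (fun B => by
    simp only [LinearMap.id_apply, sum_sum_inner_star_mul_apply, inner_self_eq_norm_sq_to_K]
    positivity) hM

/-- `Λ` is conditionally completely positive: `∑ i j, ⟨u i, Λ (B i⋆ B j) u j⟩ ≥ 0` whenever
`∑ i, B i u i = 0`. -/
def IsConditionallyCompletelyPositive (Λ : (H →L[ℂ] H) →L[ℂ] (H →L[ℂ] H)) : Prop :=
  ∀ (k : ℕ) (B : Fin k → H →L[ℂ] H) (u : Fin k → H), ∑ i, B i (u i) = 0 →
    0 ≤ ∑ i, ∑ j, ⟪u i, Λ (star (B i) * B j) (u j)⟫_ℂ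

namespace QuantumMarkovSemigroup

variable (S : QuantumMarkovSemigroup H)

theorem sum_sum_inner_resolvent_nonneg (ε : ℝ) {n : Type*} [Fintype n] (B : n → H →L[ℂ] H)
    (u : n → H) : 0 ≤ ∑ i, ∑ j, ⟪u i, S.resolvent ε (star (B i) * B j) (u j)⟫_ℂ :=
  HasSigmaWeakIntegral.sum_sum_inner_nonneg
    (fun i j => S.hasSigmaWeakIntegral_resolvent ε (star (B i) * B j))
    fun s => sum_sum_inner_nonneg_of_cstarMatrix_nonneg
      ((S.T (ε * s).toNNReal).map_cstarMatrix_nonneg _ (cstarMatrix_star_mul_nonneg B)) u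

theorem isConditionallyCompletelyPositive_yosida {ε : ℝ} (hε : 0 ≤ ε) :
    IsConditionallyCompletelyPositive (S.yosida ε) := fun k B u hBu => by
  calc 0 ≤ (ε : ℂ)⁻¹ * ∑ i, ∑ j, ⟪u i, S.resolvent ε (star (B i) * B j) (u j)⟫_ℂ :=
        mul_nonneg (by positivity) (S.sum_sum_inner_resolvent_nonneg ε B u)
    _ = (ε : ℂ)⁻¹ * (∑ i, ∑ j, ⟪u i, S.resolvent ε (star (B i) * B j) (u j)⟫_ℂ -
          ∑ i, ∑ j, ⟪u i, (star (B i) * B j) (u j)⟫_ℂ) := by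
        rw [sum_sum_inner_star_mul_apply, hBu, inner_zero_left, sub_zero]
    _ = ∑ i, ∑ j, ⟪u i, S.yosida ε (star (B i) * B j) (u j)⟫_ℂ := by
        simp only [S.yosida_apply, Finset.mul_sum, ← Finset.sum_sub_distrib, smul_apply, sub_apply,
          inner_smul_right, inner_sub_right]

end QuantumMarkovSemigroup

/-! ### The Christensen–Evans construction -/

/-- The operator `G` which Christensen and Evans associate with the conditionally completely
positive map `Λ`: `G x = Λ (|x⟩⟨T h|) h - ⟨h, Λ(T) h⟩ x / 2`. -/
def driftOperator (Λ : (H →L[ℂ] H) →L[ℂ] (H →L[ℂ] H)) (T : H →L[ℂ] H) (h : H) : H →L[ℂ] H :=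
  (ContinuousLinearMap.apply ℂ H h).comp (Λ.comp ((rankOne ℂ).flip (T h))) -
    (2⁻¹ * ⟪h, Λ T h⟫_ℂ) • ContinuousLinearMap.id ℂ H

theorem driftOperator_apply (Λ : (H →L[ℂ] H) →L[ℂ] (H →L[ℂ] H)) (T : H →L[ℂ] H) (h x : H) :
    driftOperator Λ T h x = Λ (rankOne ℂ x (T h)) h - (2⁻¹ * ⟪h, Λ T h⟫_ℂ) • x := rfl

/-- The dissipative part `A ↦ Λ A - G A - A G⋆` of `Λ` relative to the drift `G`. -/
def dissipation (Λ : (H →L[ℂ] H) →L[ℂ] (H →L[ℂ] H)) (G : H →L[ℂ] H) :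
    (H →L[ℂ] H) →ₗ[ℂ] (H →L[ℂ] H) :=
  Λ - LinearMap.mulLeft ℂ G - LinearMap.mulRight ℂ (star G)

theorem inner_dissipation_apply (Λ : (H →L[ℂ] H) →L[ℂ] (H →L[ℂ] H)) (G A : H →L[ℂ] H) (x y : H) :
    ⟪x, dissipation Λ G A y⟫_ℂ = ⟪x, Λ A y⟫_ℂ - ⟪x, G (A y)⟫_ℂ - ⟪x, A (adjoint G y)⟫_ℂ := by
  simp [dissipation, star_eq_adjoint]

theorem sum_sum_inner_dissipation {n : Type*} [Fintype n] (Λ : (H →L[ℂ] H) →L[ℂ] (H →L[ℂ] H))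
    (G : H →L[ℂ] H) (B : n → H →L[ℂ] H) {u : n → H} {w : H} (hw : ∑ i, B i (u i) = w) :
    ∑ i, ∑ j, ⟪u i, dissipation Λ G (star (B i) * B j) (u j)⟫_ℂ =
      ∑ i, ∑ j, ⟪u i, Λ (star (B i) * B j) (u j)⟫_ℂ - ∑ i, ⟪u i, G (star (B i) w)⟫_ℂ -
        star (∑ i, ⟪u i, G (star (B i) w)⟫_ℂ) := by
  have hleft : ∑ i, ∑ j, ⟪u i, G ((star (B i) * B j) (u j))⟫_ℂ =
      ∑ i, ⟪u i, G (star (B i) w)⟫_ℂ := by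
    simp only [mul_apply_eq_comp, ← inner_sum, ← map_sum, hw]
  have hright : ∑ i, ∑ j, ⟪u i, (star (B i) * B j) (adjoint G (u j))⟫_ℂ =
      star (∑ i, ⟪u i, G (star (B i) w)⟫_ℂ) := by
    rw [← hleft, Finset.sum_comm]
    simp only [star_sum]
    refine Finset.sum_congr rfl fun i _ => Finset.sum_congr rfl fun j _ => ?_
    simp only [mul_apply_eq_comp, star_eq_adjoint, adjoint_inner_right, Complex.star_def,
      inner_conj_symm]
    rw [← adjoint_inner_left (B _), ← adjoint_inner_right G]
  simp only [inner_dissipation_apply, Finset.sum_sub_distrib, hleft, hright]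

theorem sum_inner_driftOperator_star_apply (Λ : (H →L[ℂ] H) →L[ℂ] (H →L[ℂ] H)) (T : H →L[ℂ] H)
    (h : H) {n : Type*} [Fintype n] (B : n → H →L[ℂ] H) {u : n → H} {w : H}
    (hw : ∑ i, B i (u i) = w) :
    ∑ i, ⟪u i, driftOperator Λ T h (star (B i) w)⟫_ℂ =
      ∑ i, ⟪u i, Λ (rankOne ℂ (star (B i) w) (T h)) h⟫_ℂ - 2⁻¹ * ⟪h, Λ T h⟫_ℂ * ⟪w, w⟫_ℂ := by
  have hBw : ∑ i, ⟪u i, star (B i) w⟫_ℂ = ⟪w, w⟫_ℂ := by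
    simp only [star_eq_adjoint, adjoint_inner_right]
    rw [← sum_inner, hw]
  simp only [driftOperator_apply, inner_sub_right, inner_smul_right, Finset.sum_sub_distrib,
    ← Finset.mul_sum, hBw]

namespace IsConditionallyCompletelyPositive

variable {Λ : (H →L[ℂ] H) →L[ℂ] (H →L[ℂ] H)} {k : ℕ}

theorem sum_sum_inner_rankOne_nonneg (hΛ : IsConditionallyCompletelyPositive Λ)
    (hstar : ∀ A, Λ (star A) = star (Λ A)) (B : Fin k → H →L[ℂ] H) {u : Fin k → H} {w : H}
    (hw : ∑ i, B i (u i) = w) (a h : H) :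
    0 ≤ ⟪w, w⟫_ℂ * ⟪h, Λ (rankOne ℂ a a) h⟫_ℂ -
        ∑ i, ⟪u i, Λ (rankOne ℂ (star (B i) w) (⟪a, h⟫_ℂ • a)) h⟫_ℂ -
        star (∑ i, ⟪u i, Λ (rankOne ℂ (star (B i) w) (⟪a, h⟫_ℂ • a)) h⟫_ℂ) +
      star ⟪a, h⟫_ℂ * ⟪a, h⟫_ℂ * ∑ i, ∑ j, ⟪u i, Λ (star (B i) * B j) (u j)⟫_ℂ := by
  let v : Fin (k + 1) → H := Fin.cons h u
  let C : Fin (k + 1) → H →L[ℂ] H := Fin.cons (-rankOne ℂ w a) fun i => ⟪a, h⟫_ℂ • B i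
  have hCv : ∑ i, C i (v i) = 0 := by
    simp [Fin.sum_univ_succ, C, v, ← Finset.smul_sum, hw]
  have hzero : star (C 0) * C 0 = ⟪w, w⟫_ℂ • rankOne ℂ a a := by
    ext x
    simp [C, star_eq_adjoint, smul_smul, mul_comm]
  have hleft : ∀ i : Fin k, star (C i.succ) * C 0 =
      -rankOne ℂ (star (B i) w) (⟪a, h⟫_ℂ • a) := fun i => by
    ext x
    simp [C, star_eq_adjoint]
  have hright : ∀ i : Fin k, star (C 0) * C i.succ =
      star (-rankOne ℂ (star (B i) w) (⟪a, h⟫_ℂ • a)) := fun i => by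
    rw [← hleft, star_mul, star_star]
  have hsucc : ∀ i j : Fin k, star (C i.succ) * C j.succ =
      (star ⟪a, h⟫_ℂ * ⟪a, h⟫_ℂ) • (star (B i) * B j) := fun i j => by
    simp only [C, Fin.cons_succ, star_smul, smul_mul_smul]
  have hconj : ∀ (X : H →L[ℂ] H) (x : H), ⟪h, Λ (star X) x⟫_ℂ = star ⟪x, Λ X h⟫_ℂ := fun X x => by
    rw [hstar, star_eq_adjoint, adjoint_inner_right, Complex.star_def, inner_conj_symm]
  calc 0 ≤ ∑ i, ∑ j, ⟪v i, Λ (star (C i) * C j) (v j)⟫_ℂ := hΛ _ C v hCv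
    _ = _ := by
        simp only [Fin.sum_univ_succ, Finset.sum_add_distrib, hzero, hleft, hright, hsucc]
        simp only [v, Fin.cons_zero, Fin.cons_succ, hconj, map_neg, map_smul, smul_apply,
          neg_apply, inner_neg_right, inner_smul_right, star_neg, Finset.sum_neg_distrib,
          ← Finset.mul_sum, ← star_sum]
        ring

theorem sum_sum_inner_dissipation_nonneg (hΛ : IsConditionallyCompletelyPositive Λ)
    (hstar : ∀ A, Λ (star A) = star (Λ A)) {m : Type*} [Fintype m] {a : m → H} {T : H →L[ℂ] H}
    {h : H} (hT : T = ∑ s, rankOne ℂ (a s) (a s)) (hTh : ⟪h, T h⟫_ℂ = 1) (B : Fin k → H →L[ℂ] H)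
    (u : Fin k → H) :
    0 ≤ ∑ i, ∑ j, ⟪u i, dissipation Λ (driftOperator Λ T h) (star (B i) * B j) (u j)⟫_ℂ := by
  set w := ∑ i, B i (u i) with hw
  let Z : H → ℂ := fun b => ∑ i, ⟪u i, Λ (rankOne ℂ (star (B i) w) b) h⟫_ℂ
  have hT_apply : T h = ∑ s, ⟪a s, h⟫_ℂ • a s := by simp [hT, sum_apply]
  have hκ : ∑ s, ⟪h, Λ (rankOne ℂ (a s) (a s)) h⟫_ℂ = ⟪h, Λ T h⟫_ℂ := by
    simp [hT, sum_apply]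
  have hκ_star : star ⟪h, Λ T h⟫_ℂ = ⟪h, Λ T h⟫_ℂ := by
    have hT_star : star T = T := by simp [hT, star_eq_adjoint]
    rw [Complex.star_def, inner_conj_symm, ← adjoint_inner_right, ← star_eq_adjoint, ← hstar,
      hT_star]
  have hZ : ∑ s, Z (⟪a s, h⟫_ℂ • a s) = Z (T h) := by
    simp only [Z, hT_apply, map_sum, sum_apply, inner_sum]
    exact Finset.sum_comm
  have hone : ∑ s, star ⟪a s, h⟫_ℂ * ⟪a s, h⟫_ℂ = 1 := by
    rw [← hTh, hT_apply]
    simp [mul_comm]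
  calc 0 ≤ ∑ s, (⟪w, w⟫_ℂ * ⟪h, Λ (rankOne ℂ (a s) (a s)) h⟫_ℂ - Z (⟪a s, h⟫_ℂ • a s) -
          star (Z (⟪a s, h⟫_ℂ • a s)) + star ⟪a s, h⟫_ℂ * ⟪a s, h⟫_ℂ *
            ∑ i, ∑ j, ⟪u i, Λ (star (B i) * B j) (u j)⟫_ℂ) :=
        Finset.sum_nonneg fun s _ => hΛ.sum_sum_inner_rankOne_nonneg hstar B hw.symm (a s) h
    _ = ⟪w, w⟫_ℂ * ⟪h, Λ T h⟫_ℂ - Z (T h) - star (Z (T h)) +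
          ∑ i, ∑ j, ⟪u i, Λ (star (B i) * B j) (u j)⟫_ℂ := by
        simp only [Finset.sum_add_distrib, Finset.sum_sub_distrib, ← Finset.mul_sum,
          ← Finset.sum_mul, ← star_sum, hκ, hZ, hone, one_mul]
    _ = _ := by
        have hw_star : star ⟪w, w⟫_ℂ = ⟪w, w⟫_ℂ := inner_conj_symm w w
        rw [sum_sum_inner_dissipation Λ _ B hw.symm,
          sum_inner_driftOperator_star_apply Λ T h B hw.symm]
        simp only [Z, star_sub, star_mul', hκ_star, hw_star, star_inv₀, star_ofNat]
        ring

end IsConditionallyCompletelyPositive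
end CompletePositivity

/-! ### Associate vectors -/

section AssociateVector

open InnerProductSpace

variable {H : Type*} [NormedAddCommGroup H] [InnerProductSpace ℂ H]

theorem isAssociateVector_rankOne_self {e : H} (he : ‖e‖ = 1) :
    IsAssociateVector (rankOne ℂ e e) e := by
  have he0 : e ≠ 0 := norm_ne_zero_iff.1 (he ▸ one_ne_zero)
  exact ⟨rankOne_ne_zero he0 he0, 1, fun _ => e, fun _ => 1,
    orthonormal_subsingleton_iff.2 fun _ => he, by simp, by simp, by simp⟩

theorem IsAssociateVector.exists_eq_sum_rankOne {T : H →L[ℂ] H} {h : H}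
    (hT : IsAssociateVector T h) :
    ∃ (m : ℕ) (a : Fin m → H), T = ∑ s, rankOne ℂ (a s) (a s) := by
  obtain ⟨-, m, k, t, -, ht, rfl, -⟩ := hT
  refine ⟨m, fun s => ((√(t s) : ℝ) : ℂ) • k s, Finset.sum_congr rfl fun s _ => ?_⟩
  ext x
  simp only [smul_apply, rankOne_apply, inner_smul_left, Complex.conj_ofReal, smul_smul]
  rw [mul_right_comm, ← Complex.ofReal_mul, Real.mul_self_sqrt (ht s).le]

theorem IsAssociateVector.inner_apply_self {T : H →L[ℂ] H} {h : H} (hT : IsAssociateVector T h) :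
    ⟪h, T h⟫_ℂ = 1 := by
  obtain ⟨hT0, m, k, t, hk, ht, rfl, rfl⟩ := hT
  have htrace : 0 < ∑ s, t s := by
    refine Finset.sum_pos (fun s _ => ht s) (Finset.nonempty_iff_ne_empty.2 fun he => hT0 ?_)
    rw [he, Finset.sum_empty]
  set c : ℂ := ((√(∑ s, t s) : ℝ) : ℂ)⁻¹ with hc
  have hc_conj : starRingEnd ℂ c = c := by rw [hc, map_inv₀, Complex.conj_ofReal]
  have hc_sq : (∑ s, (t s : ℂ)) * (c * c) = 1 := by
    rw [← mul_inv, ← Complex.ofReal_mul, Real.mul_self_sqrt htrace.le, ← Complex.ofReal_sum]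
    exact mul_inv_cancel₀ (Complex.ofReal_ne_zero.2 htrace.ne')
  have hinner : ∀ s, ⟪k s, c • ∑ r, k r⟫_ℂ = c := fun s => by
    simp [orthonormal_iff_ite.1 hk]
  have hinner' : ∀ s, ⟪c • ∑ r, k r, k s⟫_ℂ = c := fun s => by
    rw [← inner_conj_symm, hinner, hc_conj]
  simp only [sum_apply, smul_apply, rankOne_apply, inner_sum, inner_smul_right, hinner, hinner',
    ← Finset.sum_mul, hc_sq]

end AssociateVector

/-! ### Weak limits -/

section WeakLimit

open ContinuousLinearMap InnerProductSpace

section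

variable {𝕜 E ι : Type*} [RCLike 𝕜] [NormedAddCommGroup E] [InnerProductSpace 𝕜 E]

/-- The subspace of the vectors at which the operators `F i` converge weakly along `l`. -/
def weakLimitDomain (l : Filter ι) (F : ι → E →L[𝕜] E) : Submodule 𝕜 E where
  carrier := {u | ∀ g : E, ∃ c : 𝕜, Tendsto (fun i => ⟪g, F i u⟫_𝕜) l (𝓝 c)}
  add_mem' := fun {u v} hu hv g => by
    obtain ⟨c, hc⟩ := hu g
    obtain ⟨d, hd⟩ := hv g
    exact ⟨c + d, by simpa only [map_add, inner_add_right] using hc.add hd⟩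
  zero_mem' := fun g => ⟨0, by simpa using tendsto_const_nhds⟩
  smul_mem' := fun a u hu g => by
    obtain ⟨c, hc⟩ := hu g
    exact ⟨a * c, by simpa only [map_smul, inner_smul_right] using hc.const_mul a⟩

variable [CompleteSpace E] {l : Filter ι} [l.NeBot] [l.IsCountablyGenerated]

theorem exists_tendsto_inner {x : ι → E}
    (hx : ∀ g : E, ∃ c : 𝕜, Tendsto (fun i => ⟪g, x i⟫_𝕜) l (𝓝 c)) :
    ∃ y : E, ∀ g : E, Tendsto (fun i => ⟪g, x i⟫_𝕜) l (𝓝 ⟪g, y⟫_𝕜) := by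
  choose c hc using hx
  have hconj : Tendsto (fun i g => innerSL 𝕜 (x i) g) l (𝓝 fun g => starRingEnd 𝕜 (c g)) :=
    tendsto_pi_nhds.2 fun g => ((RCLike.continuous_conj.tendsto _).comp (hc g)).congr fun i => by
      simp
  -- Banach–Steinhaus: the pointwise limit of the functionals `⟪x i, ·⟫` is bounded.
  let f : StrongDual 𝕜 E := continuousLinearMapOfTendsto (fun i => innerSL 𝕜 (x i)) hconj
  refine ⟨(toDual 𝕜 E).symm f, fun g => ?_⟩
  have hf : f g = starRingEnd 𝕜 (c g) := rfl
  rw [← inner_conj_symm, toDual_symm_apply, hf, RCLike.conj_conj]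
  exact hc g

variable (l)

/-- The weak limit of the operators `F i` along `l`, an operator on `weakLimitDomain l F`. -/
def weakLimit (F : ι → E →L[𝕜] E) : weakLimitDomain l F →ₗ[𝕜] E :=
  have hlim (u : weakLimitDomain l F) := (exists_tendsto_inner u.2).choose_spec
  { toFun u := (exists_tendsto_inner u.2).choose
    map_add' u v := ext_inner_left 𝕜 fun g => tendsto_nhds_unique (hlim (u + v) g) <| by
      simpa only [Submodule.coe_add, map_add, inner_add_right] using (hlim u g).add (hlim v g)
    map_smul' a u := ext_inner_left 𝕜 fun g => tendsto_nhds_unique (hlim (a • u) g) <| by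
      simpa only [Submodule.coe_smul, map_smul, inner_smul_right, RingHom.id_apply] using
        (hlim u g).const_mul a }

theorem tendsto_inner_weakLimit (F : ι → E →L[𝕜] E) (u : weakLimitDomain l F) (g : E) :
    Tendsto (fun i => ⟪g, F i u⟫_𝕜) l (𝓝 ⟪g, weakLimit l F u⟫_𝕜) :=
  (exists_tendsto_inner u.2).choose_spec g

end

variable {H : Type*} [NormedAddCommGroup H] [InnerProductSpace ℂ H]

/-- The sesquilinear forms `(u, v) ↦ ⟨u, L(A) v⟩ - ⟨K u, A v⟩ - ⟨u, A K v⟩`, linear in `A`: the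
analogue of `dissipation` for an unbounded generator `L` and drift `K⋆`. -/
def dissipationForm {𝒜 : Submodule ℂ (H →L[ℂ] H)} (L : 𝒜 →ₗ[ℂ] (H →L[ℂ] H)) {W : Submodule ℂ H}
    (K : W →ₗ[ℂ] H) : 𝒜 →ₗ[ℂ] (W →ₗ⋆[ℂ] W →ₗ[ℂ] ℂ) where
  toFun A :=
    ((innerₛₗ ℂ).comp W.subtype).compl₂ ((L A : H →ₗ[ℂ] H) ∘ₗ W.subtype) -
      ((innerₛₗ ℂ).comp K).compl₂ ((A : H →L[ℂ] H) ∘ₗ W.subtype) -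
      ((innerₛₗ ℂ).comp W.subtype).compl₂ ((A : H →L[ℂ] H) ∘ₗ K)
  map_add' A B := by
    ext u v
    simp [inner_add_right, add_sub_add_comm]
  map_smul' c A := by
    ext u v
    simp [mul_sub]

theorem dissipationForm_apply {𝒜 : Submodule ℂ (H →L[ℂ] H)} (L : 𝒜 →ₗ[ℂ] (H →L[ℂ] H))
    {W : Submodule ℂ H} (K : W →ₗ[ℂ] H) (A : 𝒜) (u v : W) : dissipationForm L K A u v =
      ⟪(u : H), L A v⟫_ℂ - ⟪K u, (A : H →L[ℂ] H) v⟫_ℂ - ⟪(u : H), (A : H →L[ℂ] H) (K v)⟫_ℂ := rfl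

variable [CompleteSpace H]

theorem tendsto_inner_dissipation {𝒜 : Submodule ℂ (H →L[ℂ] H)} {L : 𝒜 →ₗ[ℂ] (H →L[ℂ] H)}
    {W : Submodule ℂ H} {K : W →ₗ[ℂ] H} {ι : Type*} {l : Filter ι}
    {Λ : ι → (H →L[ℂ] H) →L[ℂ] (H →L[ℂ] H)} {G : ι → H →L[ℂ] H}
    (hL : ∀ (A : 𝒜) (x y : H), Tendsto (fun i => ⟪x, Λ i A y⟫_ℂ) l (𝓝 ⟪x, L A y⟫_ℂ))
    (hK : ∀ (u : W) (g : H), Tendsto (fun i => ⟪g, adjoint (G i) u⟫_ℂ) l (𝓝 ⟪g, K u⟫_ℂ))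
    (A : 𝒜) (u v : W) :
    Tendsto (fun i => ⟪(u : H), dissipation (Λ i) (G i) A v⟫_ℂ) l
      (𝓝 (dissipationForm L K A u v)) := by
  simp only [dissipationForm_apply, inner_dissipation_apply]
  refine ((hL A u v).sub ?_).sub ?_
  · have hconj := (Complex.continuous_conj.tendsto _).comp (hK u ((A : H →L[ℂ] H) v))
    rw [inner_conj_symm] at hconj
    refine hconj.congr fun i => ?_
    rw [Function.comp_apply, inner_conj_symm, adjoint_inner_left]
  · simpa only [adjoint_inner_left] using hK v (adjoint (A : H →L[ℂ] H) u)

theorem isUCompletelyPositive_dissipationForm {𝒜 : Submodule ℂ (H →L[ℂ] H)}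
    {L : 𝒜 →ₗ[ℂ] (H →L[ℂ] H)} {W : Submodule ℂ H} {K : W →ₗ[ℂ] H} {ι : Type*} {l : Filter ι}
    [l.NeBot] {Λ : ι → (H →L[ℂ] H) →L[ℂ] (H →L[ℂ] H)} {T : H →L[ℂ] H} {h : H}
    (hT : IsAssociateVector T h) (hΛ : ∀ᶠ i in l, IsConditionallyCompletelyPositive (Λ i))
    (hstar : ∀ i A, Λ i (star A) = star (Λ i A))
    (hL : ∀ (A : 𝒜) (x y : H), Tendsto (fun i => ⟪x, Λ i A y⟫_ℂ) l (𝓝 ⟪x, L A y⟫_ℂ))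
    (hK : ∀ (u : W) (g : H),
      Tendsto (fun i => ⟪g, adjoint (driftOperator (Λ i) T h) u⟫_ℂ) l (𝓝 ⟪g, K u⟫_ℂ)) :
    IsUCompletelyPositive (dissipationForm L K) := by
  intro k A hA u
  obtain ⟨m, a, hTa⟩ := hT.exists_eq_sum_rankOne
  refine ge_of_tendsto (tendsto_finsetSum _ fun i _ => tendsto_finsetSum _ fun j _ =>
    tendsto_inner_dissipation hL hK (A i j) (u i) (u j)) ?_
  filter_upwards [hΛ] with n hn
  exact sum_sum_inner_map_nonneg_of_star_mul _ (fun i => (u i : H))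
    (fun B => hn.sum_sum_inner_dissipation_nonneg (hstar n) hTa hT.inner_apply_self B _) hA

theorem QuantumMarkovSemigroup.exists_generator_decomposition (S : QuantumMarkovSemigroup H)
    {T : H →L[ℂ] H} {h : H} (hT : IsAssociateVector T h) :
    ∃ (W : Submodule ℂ H) (φ : S.domain →ₗ[ℂ] (W →ₗ⋆[ℂ] W →ₗ[ℂ] ℂ)) (K : W →ₗ[ℂ] H),
      (∀ u : H, u ∈ W ↔ ∀ g : H, ∃ c : ℂ,
        Tendsto (fun ε => ⟪g, adjoint (driftOperator (S.yosida ε) T h) u⟫_ℂ) (𝓝[>] 0) (𝓝 c)) ∧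
      (∀ (u : W) (g : H), Tendsto
        (fun ε => ⟪g, adjoint (driftOperator (S.yosida ε) T h) u⟫_ℂ) (𝓝[>] 0) (𝓝 ⟪g, K u⟫_ℂ)) ∧
      IsUCompletelyPositive φ ∧
      ∀ (A : S.domain) (u v : W),
        ⟪(u : H), S.generator A v⟫_ℂ =
          φ A u v + ⟪K u, (A : H →L[ℂ] H) v⟫_ℂ + ⟪(u : H), (A : H →L[ℂ] H) (K v)⟫_ℂ := by
  let F : ℝ → H →L[ℂ] H := fun ε => adjoint (driftOperator (S.yosida ε) T h)
  have hccp : ∀ᶠ ε in 𝓝[>] (0 : ℝ), IsConditionallyCompletelyPositive (S.yosida ε) :=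
    eventually_nhdsWithin_of_forall fun ε (hε : 0 < ε) =>
      S.isConditionallyCompletelyPositive_yosida hε.le
  have hK := tendsto_inner_weakLimit (𝓝[>] (0 : ℝ)) F
  refine ⟨weakLimitDomain (𝓝[>] 0) F, dissipationForm S.generator (weakLimit (𝓝[>] 0) F),
    weakLimit (𝓝[>] 0) F, fun u => Iff.rfl, hK,
    isUCompletelyPositive_dissipationForm hT hccp S.yosida_star S.tendsto_inner_yosida hK,
    fun A u v => ?_⟩
  rw [dissipationForm_apply]
  ring

end WeakLimit

end

theorem theorem3p6 {H : Type*} [NormedAddCommGroup H] [InnerProductSpace ℂ H] [CompleteSpace H]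
    (S : QuantumMarkovSemigroup H) :
    (∃ (W : Submodule ℂ H) (φ : S.domain →ₗ[ℂ] (W →ₗ⋆[ℂ] W →ₗ[ℂ] ℂ)) (K : W →ₗ[ℂ] H),
      IsUCompletelyPositive φ ∧
      ∀ (A : S.domain) (u v : W),
        ⟪(u : H), S.generator A v⟫_ℂ =
          φ A u v + ⟪K u, (A : H →L[ℂ] H) v⟫_ℂ + ⟪(u : H), (A : H →L[ℂ] H) (K v)⟫_ℂ) ∧
    ∃ Lε : ℝ → (H →L[ℂ] H) →L[ℂ] (H →L[ℂ] H),
      (∀ ε, 0 < ε → IsYosidaApproximation S.generator ε (Lε ε)) ∧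
      ∀ (T : H →L[ℂ] H) (h : H), IsAssociateVector T h →
        ∃ G : ℝ → (H →L[ℂ] H),
          (∀ ε, 0 < ε → ∀ x : H, G ε x =
            Lε ε (InnerProductSpace.rankOne ℂ x (T h)) h - (2⁻¹ * ⟪h, Lε ε T h⟫_ℂ) • x) ∧
          ∃ (W : Submodule ℂ H) (φ : S.domain →ₗ[ℂ] (W →ₗ⋆[ℂ] W →ₗ[ℂ] ℂ)) (K : W →ₗ[ℂ] H),
            (∀ u : H, u ∈ W ↔ ∀ g : H, ∃ c : ℂ,
              Tendsto (fun ε => ⟪g, ContinuousLinearMap.adjoint (G ε) u⟫_ℂ) (𝓝[>] 0) (𝓝 c)) ∧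
            (∀ (u : W) (g : H), Tendsto (fun ε => ⟪g, ContinuousLinearMap.adjoint (G ε) u⟫_ℂ)
              (𝓝[>] 0) (𝓝 ⟪g, K u⟫_ℂ)) ∧
            IsUCompletelyPositive φ ∧
            ∀ (A : S.domain) (u v : W),
              ⟪(u : H), S.generator A v⟫_ℂ =
                φ A u v + ⟪K u, (A : H →L[ℂ] H) v⟫_ℂ + ⟪(u : H), (A : H →L[ℂ] H) (K v)⟫_ℂ := by
  have hmain := fun (T : H →L[ℂ] H) (h : H) (hT : IsAssociateVector T h) =>
    S.exists_generator_decomposition hT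
  refine ⟨?_, S.yosida, fun ε hε => S.isYosidaApproximation_yosida hε, fun T h hT =>
    ⟨fun ε => driftOperator (S.yosida ε) T h, fun ε _ x => driftOperator_apply _ T h x,
      hmain T h hT⟩⟩
  rcases subsingleton_or_nontrivial H with hH | hH
  · refine ⟨⊤, 0, 0, fun k A _ u => by simp, fun A u v => ?_⟩
    rw [Subsingleton.elim (u : H) 0]
    simp
  · obtain ⟨e, he⟩ := exists_norm_eq H zero_le_one
    obtain ⟨W, φ, K, -, -, hφ, hL⟩ := hmain _ e (isAssociateVector_rankOne_self he)
    exact ⟨W, φ, K, hφ, hL⟩
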